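/- Let $B$ be the combinator $\lambda x.\lambda y.\lambda z.\,x\,(y\,z)$. A $B$-term is a combinatory term built by application from $B$ alone; each $B$-term is identified with the corresponding untyped $\lambda$-term, and two $B$-terms are called equivalent if their $\lambda$-terms are $\beta\eta$-equivalent. For $B$-terms $e_1,e_2$ write $e_1\circ e_2 = B\,e_1\,e_2$, and for $n\ge 0$ write $B^nB = B(B(\cdots(B\,B)\cdots))$, where $B$ is applied $n$ times in succession to the last $B$ (so $B^0B=B$). A polynomial is a $B$-term $(B^{n_1}B)\circ(B^{n_2}B)\circ\cdots\circ(B^{n_k}B)$ with $k\ge 1$ and integers $n_1,\dots,n_k\ge 0$, called its degrees, where the compositions may be bracketed in any way; it is decreasing if $n_1\ge n_2\ge\cdots\ge n_k$. Theorem. Every $B$-term $e$ is equivalent to a decreasing polynomial, and this polynomial is unique up to the bracketing of the compositions. That is, there is exactly one finite nonempty weakly decreasing sequence $n_1\ge n_2\ge\cdots\ge n_k\ge 0$ of integers such that $e$ is equivalent to $(B^{n_1}B)\circ(B^{n_2}B)\circ\cdots\circ(B^{n_k}B)$; for this sequence the equivalence holds in every bracketing, and for no other weakly decreasing sequence does it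 hold in any bracketing. -/

import Mathlib

/-- Untyped `λ`-terms in de Bruijn notation: `var n` refers to the `n`-th enclosing `lam`,
counted from `0` at the innermost one; the remaining indices are free variables. -/
inductive LambdaTerm : Type
  | var : ℕ → LambdaTerm
  | app : LambdaTerm → LambdaTerm → LambdaTerm
  | lam : LambdaTerm → LambdaTerm

namespace LambdaTerm

/-- The action of a renaming on the variables below one more binder. -/
def liftRename (ρ : ℕ → ℕ) : ℕ → ℕ
  | 0 => 0
  | n + 1 => ρ n + 1

/-- Capture-avoiding renaming of the free variables. -/
def rename : (ℕ → ℕ) → LambdaTerm → LambdaTerm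
  | ρ, var n => var (ρ n)
  | ρ, app s t => app (rename ρ s) (rename ρ t)
  | ρ, lam t => lam (rename (liftRename ρ) t)

/-- Weakening by one fresh variable, which becomes the variable `0`. -/
def shift (t : LambdaTerm) : LambdaTerm := rename Nat.succ t

/-- The action of a substitution on the variables below one more binder. -/
def liftSubst (σ : ℕ → LambdaTerm) : ℕ → LambdaTerm
  | 0 => var 0
  | n + 1 => shift (σ n)

/-- Capture-avoiding simultaneous substitution for the free variables. -/
def subst : (ℕ → LambdaTerm) → LambdaTerm → LambdaTerm
  | σ, var n => σ n
  | σ, app s t => app (subst σ s) (subst σ t)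
  | σ, lam t => lam (subst (liftSubst σ) t)

/-- The substitution `0 ↦ s`, `n + 1 ↦ var n`, used to contract a `β`-redex. -/
def single (s : LambdaTerm) : ℕ → LambdaTerm
  | 0 => s
  | n + 1 => var n

/-- `βη`-equivalence: the least congruence on `λ`-terms with `(λx. t) s = t[x := s]` and
`λx. t x = t` whenever `x` is not free in `t`. -/
inductive BetaEta : LambdaTerm → LambdaTerm → Prop
  | beta (t s : LambdaTerm) : BetaEta (app (lam t) s) (subst (single s) t)
  | eta (t : LambdaTerm) : BetaEta (lam (app (shift t) (var 0))) t
  | congrApp {s s' t t' : LambdaTerm} :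
      BetaEta s s' → BetaEta t t' → BetaEta (app s t) (app s' t')
  | congrLam {t t' : LambdaTerm} : BetaEta t t' → BetaEta (lam t) (lam t')
  | refl (t : LambdaTerm) : BetaEta t t
  | symm {s t : LambdaTerm} : BetaEta s t → BetaEta t s
  | trans {s t u : LambdaTerm} : BetaEta s t → BetaEta t u → BetaEta s u

/-- The combinator `B = λx. λy. λz. x (y z)`. -/
def bluebird : LambdaTerm :=
  lam (lam (lam (app (var 2) (app (var 1) (var 0)))))

end LambdaTerm

/-- `B`-terms: the combinatory terms built by application from the single combinator `B`. -/
inductive BTerm : Type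
  | B : BTerm
  | app : BTerm → BTerm → BTerm

namespace BTerm

/-- The `λ`-term corresponding to a `B`-term. -/
def toLambda : BTerm → LambdaTerm
  | B => LambdaTerm.bluebird
  | app s t => LambdaTerm.app (toLambda s) (toLambda t)

/-- Equivalence of `B`-terms: `βη`-equivalence of the corresponding `λ`-terms. -/
def Equivalent (s t : BTerm) : Prop := LambdaTerm.BetaEta s.toLambda t.toLambda

/-- The composition `s ∘ t`, that is, the `B`-term `B s t`. -/
def comp (s t : BTerm) : BTerm := app (app B s) t

/-- The monomial `Bⁿ B = B (B (⋯ (B B) ⋯))`, with `n` applications of `B` to the last `B`. -/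
def monomial : ℕ → BTerm
  | 0 => B
  | n + 1 => app B (monomial n)

end BTerm

/-- Polynomials `(B^{n₁} B) ∘ ⋯ ∘ (B^{nₖ} B)` with `k > 0`, in any bracketing of the
compositions. -/
inductive BPolynomial : Type
  | monomial : ℕ → BPolynomial
  | comp : BPolynomial → BPolynomial → BPolynomial

namespace BPolynomial

/-- The `B`-term denoted by a polynomial. -/
def toBTerm : BPolynomial → BTerm
  | monomial n => BTerm.monomial n
  | comp P Q => BTerm.comp (toBTerm P) (toBTerm Q)

/-- The sequence `n₁, …, nₖ` of the degrees of a polynomial, from left to right. It is nonempty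
and determines the polynomial up to the bracketing of the compositions. -/
def degrees : BPolynomial → List ℕ
  | monomial n => [n]
  | comp P Q => degrees P ++ degrees Q

/-- A polynomial is decreasing when `n₁ ≥ n₂ ≥ ⋯ ≥ nₖ`. -/
def Decreasing (P : BPolynomial) : Prop := P.degrees.Pairwise (fun m n => m ≥ n)

end BPolynomial

namespace LambdaTerm

/-! ### Renaming and substitution -/

/-! Existence is algebra modulo `βη`. Composition is a monoid law with unit `I`, and `x ↦ B x` is an
endomorphism of that monoid (`Class.B_app_comp`), so it raises every degree of a polynomial by one.
Since `B^(n+1) B` applied to `y` is `(B^n B) ∘ y`, polynomials are closed under application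
(`Class.exists_poly_eq_app`). The relation `Class.monomial_comp_monomial` then sorts the degrees by
insertion.

Uniqueness comes from the action on arguments. Applied to `x, f 0, f 1, …`, the monomial of degree
`n` replaces `f n, f (n + 1)` by their application (`spine_monomial`). On variables the result
contains no abstraction, hence is normal, and Church–Rosser turns equivalence into syntactic
equality. For a decreasing polynomial the last merge is at the least degree, which can be read off
and undone (`eq_of_mergeAll_eq`). -/

theorem liftRename_comp (ρ τ : ℕ → ℕ) :
    liftRename ρ ∘ liftRename τ = liftRename (ρ ∘ τ) := by
  funext n
  cases n <;> rfl

theorem rename_rename (t : LambdaTerm) : ∀ ρ τ : ℕ → ℕ,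
    rename ρ (rename τ t) = rename (ρ ∘ τ) t := by
  induction t with
  | var n => intro ρ τ; rfl
  | app s t hs ht => intro ρ τ; simp only [rename, hs, ht]
  | lam t ht => intro ρ τ; simp only [rename, ht, liftRename_comp]

theorem liftSubst_comp_liftRename (σ : ℕ → LambdaTerm) (ρ : ℕ → ℕ) :
    liftSubst σ ∘ liftRename ρ = liftSubst (σ ∘ ρ) := by
  funext n
  cases n <;> rfl

theorem subst_rename (t : LambdaTerm) : ∀ (σ : ℕ → LambdaTerm) (ρ : ℕ → ℕ),
    subst σ (rename ρ t) = subst (σ ∘ ρ) t := by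
  induction t with
  | var n => intro σ ρ; rfl
  | app s t hs ht => intro σ ρ; simp only [rename, subst, hs, ht]
  | lam t ht => intro σ ρ; simp only [rename, subst, ht, liftSubst_comp_liftRename]

theorem rename_comp_liftSubst (σ : ℕ → LambdaTerm) (ρ : ℕ → ℕ) :
    rename (liftRename ρ) ∘ liftSubst σ = liftSubst (rename ρ ∘ σ) := by
  funext n
  cases n with
  | zero => rfl
  | succ n =>
    simp only [Function.comp_apply, liftSubst, shift, rename_rename]
    rfl

theorem rename_subst (t : LambdaTerm) : ∀ (ρ : ℕ → ℕ) (σ : ℕ → LambdaTerm),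
    rename ρ (subst σ t) = subst (rename ρ ∘ σ) t := by
  induction t with
  | var n => intro ρ σ; rfl
  | app s t hs ht => intro ρ σ; simp only [rename, subst, hs, ht]
  | lam t ht => intro ρ σ; simp only [rename, subst, ht, rename_comp_liftSubst]

theorem subst_comp_liftSubst (σ τ : ℕ → LambdaTerm) :
    subst (liftSubst σ) ∘ liftSubst τ = liftSubst (subst σ ∘ τ) := by
  funext n
  cases n with
  | zero => rfl
  | succ n =>
    simp only [Function.comp_apply, liftSubst, shift, rename_subst, subst_rename]
    rfl

theorem subst_subst (t : LambdaTerm) : ∀ σ τ : ℕ → LambdaTerm,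
    subst σ (subst τ t) = subst (subst σ ∘ τ) t := by
  induction t with
  | var n => intro σ τ; rfl
  | app s t hs ht => intro σ τ; simp only [subst, hs, ht]
  | lam t ht => intro σ τ; simp only [subst, ht, subst_comp_liftSubst]

theorem liftSubst_var : liftSubst var = var := by
  funext n
  cases n <;> rfl

theorem subst_var (t : LambdaTerm) : subst var t = t := by
  induction t with
  | var n => rfl
  | app s t hs ht => simp only [subst, hs, ht]
  | lam t ht => simp only [subst, liftSubst_var, ht]

theorem subst_single_shift (s t : LambdaTerm) : subst (single s) (shift t) = t := by
  rw [shift, subst_rename]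
  exact subst_var t

theorem subst_single_var_zero (t : LambdaTerm) :
    subst (single (var 0)) (rename (liftRename Nat.succ) t) = t := by
  rw [subst_rename]
  convert subst_var t
  funext n
  cases n <;> rfl

theorem subst_liftSubst_shift (σ : ℕ → LambdaTerm) (t : LambdaTerm) :
    subst (liftSubst σ) (shift t) = shift (subst σ t) := by
  rw [shift, shift, subst_rename, rename_subst]
  rfl

theorem rename_liftRename_shift (ρ : ℕ → ℕ) (t : LambdaTerm) :
    rename (liftRename ρ) (shift t) = shift (rename ρ t) := by
  rw [shift, shift, rename_rename, rename_rename]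
  rfl

theorem subst_subst_single (σ : ℕ → LambdaTerm) (t s : LambdaTerm) :
    subst σ (subst (single s) t) = subst (single (subst σ s)) (subst (liftSubst σ) t) := by
  rw [subst_subst, subst_subst]
  congr 1
  funext n
  cases n with
  | zero => rfl
  | succ n => exact (subst_single_shift _ _).symm

theorem rename_subst_single (ρ : ℕ → ℕ) (t s : LambdaTerm) :
    rename ρ (subst (single s) t) = subst (single (rename ρ s)) (rename (liftRename ρ) t) := by
  rw [rename_subst, subst_rename]
  congr 1
  funext n
  cases n <;> rfl

/-- Renaming preserves pullback squares of maps between variables. -/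
theorem exists_of_rename_eq_rename (a : LambdaTerm) : ∀ (s : LambdaTerm) (ρ τ ρ' τ' : ℕ → ℕ),
    (∀ i j, ρ i = τ j → ∃ k, i = τ' k ∧ j = ρ' k) → rename ρ a = rename τ s →
      ∃ c, a = rename τ' c ∧ s = rename ρ' c := by
  induction a with
  | var n =>
    intro s ρ τ ρ' τ' h e
    cases s <;> simp only [rename, var.injEq, reduceCtorEq] at e
    obtain ⟨k, rfl, rfl⟩ := h _ _ e
    exact ⟨var k, rfl, rfl⟩
  | app a b ha hb =>
    intro s ρ τ ρ' τ' h e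
    cases s <;> simp only [rename, app.injEq, reduceCtorEq] at e
    obtain ⟨c, rfl, rfl⟩ := ha _ _ _ _ _ h e.1
    obtain ⟨d, rfl, rfl⟩ := hb _ _ _ _ _ h e.2
    exact ⟨app c d, rfl, rfl⟩
  | lam a ha =>
    intro s ρ τ ρ' τ' h e
    cases s <;> simp only [rename, lam.injEq, reduceCtorEq] at e
    obtain ⟨c, rfl, rfl⟩ := ha _ _ _ (liftRename ρ') (liftRename τ') (by
      intro i j hij
      match i, j, hij with
      | 0, 0, _ => exact ⟨0, rfl, rfl⟩
      | i + 1, j + 1, hij =>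
        obtain ⟨k, rfl, rfl⟩ := h i j (Nat.succ_injective hij)
        exact ⟨k + 1, rfl, rfl⟩) e
    exact ⟨lam c, rfl, rfl⟩

theorem rename_injective {ρ : ℕ → ℕ} (hρ : Function.Injective ρ) :
    Function.Injective (rename ρ) := by
  intro s t h
  obtain ⟨c, rfl, rfl⟩ := exists_of_rename_eq_rename s t ρ ρ id id
    (fun i j hij => ⟨i, rfl, (hρ hij).symm⟩) h
  rfl

theorem liftRename_injective {ρ : ℕ → ℕ} (hρ : Function.Injective ρ) :
    Function.Injective (liftRename ρ) := by
  intro i j h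
  cases i <;> cases j <;> simp [liftRename] at h ⊢
  exact hρ h

theorem shift_injective : Function.Injective shift :=
  rename_injective Nat.succ_injective

/-! ### Confluence -/

/-- Parallel `βη`-reduction. -/
inductive Par : LambdaTerm → LambdaTerm → Prop
  | var (n : ℕ) : Par (var n) (var n)
  | app {s s' t t' : LambdaTerm} : Par s s' → Par t t' → Par (app s t) (app s' t')
  | lam {t t' : LambdaTerm} : Par t t' → Par (lam t) (lam t')
  | beta {t t' s s' : LambdaTerm} :
      Par t t' → Par s s' → Par (LambdaTerm.app (LambdaTerm.lam t) s) (subst (single s') t')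
  | eta {t t' : LambdaTerm} :
      Par t t' → Par (LambdaTerm.lam (LambdaTerm.app (shift t) (LambdaTerm.var 0))) t'

theorem Par.refl (t : LambdaTerm) : Par t t := by
  induction t with
  | var n => exact .var n
  | app s t hs ht => exact .app hs ht
  | lam t ht => exact .lam ht

theorem Par.rename {s t : LambdaTerm} (h : Par s t) :
    ∀ ρ : ℕ → ℕ, Par (LambdaTerm.rename ρ s) (LambdaTerm.rename ρ t) := by
  induction h with
  | var n => intro ρ; exact .var _
  | app _ _ hs ht => intro ρ; exact .app (hs ρ) (ht ρ)
  | lam _ ht => intro ρ; exact .lam (ht _)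
  | beta _ _ ht hs => intro ρ; rw [rename_subst_single]; exact .beta (ht _) (hs _)
  | eta _ ht =>
    intro ρ
    simp only [LambdaTerm.rename, rename_liftRename_shift]
    exact .eta (ht ρ)

theorem Par.liftSubst {σ σ' : ℕ → LambdaTerm} (h : ∀ n, Par (σ n) (σ' n)) (n : ℕ) :
    Par (LambdaTerm.liftSubst σ n) (LambdaTerm.liftSubst σ' n) := by
  cases n with
  | zero => exact .var 0
  | succ n => exact (h n).rename _

theorem Par.subst {s t : LambdaTerm} (h : Par s t) : ∀ {σ σ' : ℕ → LambdaTerm},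
    (∀ n, Par (σ n) (σ' n)) → Par (LambdaTerm.subst σ s) (LambdaTerm.subst σ' t) := by
  induction h with
  | var n => intro σ σ' hσ; exact hσ n
  | app _ _ hs ht => intro σ σ' hσ; exact .app (hs hσ) (ht hσ)
  | lam _ ht => intro σ σ' hσ; exact .lam (ht (Par.liftSubst hσ))
  | beta _ _ ht hs =>
    intro σ σ' hσ
    rw [subst_subst_single]
    exact .beta (ht (Par.liftSubst hσ)) (hs hσ)
  | eta _ ht =>
    intro σ σ' hσ
    simp only [LambdaTerm.subst, subst_liftSubst_shift]
    exact .eta (ht hσ)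

theorem Par.subst_single {s s' t t' : LambdaTerm} (ht : Par t t') (hs : Par s s') :
    Par (LambdaTerm.subst (single s) t) (LambdaTerm.subst (single s') t') :=
  ht.subst fun n => by
    cases n with
    | zero => exact hs
    | succ n => exact .var n

/-- An injective renaming creates no redexes, so reductions can be pulled back along it. This
handles steps inside the `shift t` of an `η`-redex. -/
theorem Par.exists_of_rename {a u : LambdaTerm} (h : Par a u) :
    ∀ {ρ : ℕ → ℕ} {t : LambdaTerm}, Function.Injective ρ → a = LambdaTerm.rename ρ t →
      ∃ t', u = LambdaTerm.rename ρ t' ∧ Par t t' := by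
  induction h with
  | var n =>
    intro ρ t _ e
    exact ⟨t, e, .refl t⟩
  | app _ _ hs ht =>
    intro ρ t hρ e
    cases t <;> simp only [LambdaTerm.rename, app.injEq, reduceCtorEq] at e
    obtain ⟨s', rfl, hs'⟩ := hs hρ e.1
    obtain ⟨t', rfl, ht'⟩ := ht hρ e.2
    exact ⟨_, rfl, .app hs' ht'⟩
  | lam _ ht =>
    intro ρ t hρ e
    cases t <;> simp only [LambdaTerm.rename, lam.injEq, reduceCtorEq] at e
    obtain ⟨t', rfl, ht'⟩ := ht (liftRename_injective hρ) e
    exact ⟨_, rfl, .lam ht'⟩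
  | beta _ _ ht hs =>
    intro ρ t hρ e
    cases t with
    | app a b =>
      cases a <;> simp only [LambdaTerm.rename, app.injEq, lam.injEq, reduceCtorEq, false_and] at e
      obtain ⟨t', rfl, ht'⟩ := ht (liftRename_injective hρ) e.1
      obtain ⟨s', rfl, hs'⟩ := hs hρ e.2
      exact ⟨_, (rename_subst_single _ _ _).symm, .beta ht' hs'⟩
    | _ => simp only [LambdaTerm.rename, reduceCtorEq] at e
  | @eta s s' _ ht =>
    intro ρ t hρ e
    cases t with
    | lam t =>
      cases t with
      | app a b =>
        simp only [LambdaTerm.rename, lam.injEq, app.injEq] at e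
        -- The function part avoids variable `0` after renaming, hence already before it: `a` is
        -- itself a shift.
        obtain ⟨c, rfl, rfl⟩ := exists_of_rename_eq_rename a s (liftRename ρ) Nat.succ ρ Nat.succ
          (by
            intro i j hij
            cases i <;> simp [liftRename] at hij
            exact ⟨_, rfl, hij.symm⟩) e.1.symm
        obtain ⟨t', rfl, ht'⟩ := ht hρ rfl
        have hb : b = .var 0 := rename_injective (liftRename_injective hρ) e.2.symm
        subst hb
        exact ⟨t', rfl, .eta ht'⟩
      | _ => simp only [LambdaTerm.rename, lam.injEq, reduceCtorEq] at e
    | _ => simp only [LambdaTerm.rename, reduceCtorEq] at e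

theorem Par.exists_of_shift {t u : LambdaTerm} (h : Par (shift t) u) :
    ∃ t', u = shift t' ∧ Par t t' :=
  h.exists_of_rename Nat.succ_injective rfl

/-- The number of constructors of a term. -/
def size : LambdaTerm → ℕ
  | var _ => 1
  | app s t => size s + size t + 1
  | lam t => size t + 1

theorem size_rename (t : LambdaTerm) : ∀ ρ : ℕ → ℕ, size (rename ρ t) = size t := by
  induction t with
  | var n => intro ρ; rfl
  | app s t hs ht => intro ρ; simp only [rename, size, hs, ht]
  | lam t ht => intro ρ; simp only [rename, size, ht]

/-- Any two parallel reducts of `t` have a common parallel reduct. -/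
def Diamond (t : LambdaTerm) : Prop :=
  ∀ a b, Par t a → Par t b → ∃ c, Par a c ∧ Par b c

theorem Par.join_app_beta {t s u v t' s' : LambdaTerm} (iht : Diamond t) (ihs : Diamond s)
    (hu : Par (LambdaTerm.lam t) u) (hv : Par s v) (ht : Par t t') (hs : Par s s') :
    ∃ c, Par (LambdaTerm.app u v) c ∧ Par (LambdaTerm.subst (single s') t') c := by
  obtain ⟨d, hvd, hsd⟩ := ihs _ _ hv hs
  cases hu with
  | lam hu =>
    obtain ⟨c, huc, htc⟩ := iht _ _ hu ht
    exact ⟨_, .beta huc hvd, htc.subst_single hsd⟩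
  | eta hu =>
    -- The `η`-reduct is expanded again to a reduct of the body; substituting the argument for `var
    -- 0` then gives back `app u v`.
    obtain ⟨c, huc, htc⟩ := iht _ _ (.app (hu.rename Nat.succ) (.var 0)) ht
    refine ⟨_, ?_, htc.subst_single hsd⟩
    have h := huc.subst_single hvd
    simp only [LambdaTerm.subst, single] at h
    rwa [← shift, subst_single_shift] at h

theorem Par.join_lam_eta {t u t' : LambdaTerm} (ih : Diamond t)
    (hu : Par (LambdaTerm.app (shift t) (LambdaTerm.var 0)) u) (ht : Par t t') :
    ∃ c, Par (LambdaTerm.lam u) c ∧ Par t' c := by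
  generalize hs : shift t = s at hu
  cases hu with
  | app h₁ h₂ =>
    subst hs
    obtain ⟨t₁, rfl, h₃⟩ := h₁.exists_of_shift
    cases h₂
    obtain ⟨c, h, h'⟩ := ih _ _ h₃ ht
    exact ⟨c, .eta h, h'⟩
  | beta h₁ h₂ =>
    cases h₂
    cases t <;> simp only [shift, LambdaTerm.rename, lam.injEq, reduceCtorEq] at hs
    subst hs
    obtain ⟨t₁, rfl, h₃⟩ := h₁.exists_of_rename (liftRename_injective Nat.succ_injective) rfl
    -- Contracting `(shift (λ t)) 0` under the binder only restores the body, so the result is again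
    -- a reduct of `λ t`.
    rw [subst_single_var_zero]
    exact ih _ _ (.lam h₃) ht

/-- The induction is on size because the `η` case needs the property for `t`, whereas only `shift t`
is a subterm. -/
theorem diamond_of_size_lt (n : ℕ) : ∀ t, size t < n → Diamond t := by
  induction n with
  | zero => intro t h; omega
  | succ n ih =>
    intro t h a b ha hb
    cases t with
    | var => cases ha; exact ⟨b, hb, .refl b⟩
    | app s t =>
      have ihs : Diamond s := ih _ (by simp only [size] at h; omega)
      have iht : Diamond t := ih _ (by simp only [size] at h; omega)
      cases ha with
      | app ha ha' =>
        cases hb with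
        | app hb hb' =>
          obtain ⟨c, h₁, h₂⟩ := ihs _ _ ha hb
          obtain ⟨d, h₃, h₄⟩ := iht _ _ ha' hb'
          exact ⟨_, .app h₁ h₃, .app h₂ h₄⟩
        | beta hb hb' =>
          exact Par.join_app_beta (ih _ (by simp only [size] at h; omega)) iht ha ha' hb hb'
      | @beta s _ _ _ ha ha' =>
        have ihs' : Diamond s := ih _ (by simp only [size] at h; omega)
        cases hb with
        | app hb hb' =>
          obtain ⟨c, h₁, h₂⟩ := Par.join_app_beta ihs' iht hb hb' ha ha'
          exact ⟨c, h₂, h₁⟩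
        | beta hb hb' =>
          obtain ⟨c, h₁, h₂⟩ := ihs' _ _ ha hb
          obtain ⟨d, h₃, h₄⟩ := iht _ _ ha' hb'
          exact ⟨_, h₁.subst_single h₃, h₂.subst_single h₄⟩
    | lam t =>
      have iht : Diamond t := ih _ (by simp only [size] at h; omega)
      cases ha with
      | lam ha =>
        cases hb with
        | lam hb =>
          obtain ⟨c, h₁, h₂⟩ := iht _ _ ha hb
          exact ⟨_, .lam h₁, .lam h₂⟩
        | eta hb =>
          exact Par.join_lam_eta (ih _ (by simp only [size, shift, size_rename] at h; omega)) ha hb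
      | @eta s _ ha =>
        have ihs : Diamond s := ih _ (by simp only [size, shift, size_rename] at h; omega)
        generalize e : LambdaTerm.app (shift s) (var 0) = t at hb
        cases hb with
        | lam hb =>
          subst e
          obtain ⟨c, h₁, h₂⟩ := Par.join_lam_eta ihs hb ha
          exact ⟨c, h₂, h₁⟩
        | eta hb =>
          rw [app.injEq] at e
          obtain rfl := shift_injective e.1
          exact ihs _ _ ha hb

theorem diamond (t : LambdaTerm) : Diamond t :=
  diamond_of_size_lt _ t (Nat.lt_succ_self _)

/-- The Church–Rosser theorem for `βη`-equivalence. -/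
theorem BetaEta.join {s t : LambdaTerm} (h : BetaEta s t) :
    Relation.Join (Relation.ReflTransGen Par) s t := by
  have hequiv : Equivalence (Relation.Join (Relation.ReflTransGen Par)) :=
    Relation.equivalence_join_reflTransGen fun a b c hb hc =>
      let ⟨d, hbd, hcd⟩ := diamond a b c hb hc
      ⟨d, .single hbd, .single hcd⟩
  induction h with
  | beta t s => exact ⟨_, .single (.beta (.refl t) (.refl s)), .refl⟩
  | eta t => exact ⟨_, .single (.eta (.refl t)), .refl⟩
  | @congrApp s s' t t' _ _ hs ht =>
    obtain ⟨c, hc, hc'⟩ := hs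
    obtain ⟨d, hd, hd'⟩ := ht
    exact ⟨app c d,
      (hc.lift (app · t) fun _ _ h => .app h (.refl t)).trans
        (hd.lift (app c) fun _ _ h => .app (.refl c) h),
      (hc'.lift (app · t') fun _ _ h => .app h (.refl t')).trans
        (hd'.lift (app c) fun _ _ h => .app (.refl c) h)⟩
  | congrLam _ ht =>
    obtain ⟨c, hc, hc'⟩ := ht
    exact ⟨lam c, hc.lift lam fun _ _ h => .lam h, hc'.lift lam fun _ _ h => .lam h⟩
  | refl t => exact hequiv.refl t
  | symm _ h => exact hequiv.symm h
  | trans _ _ h h' => exact hequiv.trans h h'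

/-- Terms without abstractions. -/
inductive LamFree : LambdaTerm → Prop
  | var (n : ℕ) : LamFree (var n)
  | app {s t : LambdaTerm} : LamFree s → LamFree t → LamFree (app s t)

theorem LamFree.eq_of_par {s : LambdaTerm} (hs : LamFree s) : ∀ {t}, Par s t → t = s := by
  induction hs with
  | var n => intro t h; cases h; rfl
  | app hs _ ihs iht =>
    intro t h
    cases h with
    | app h h' => rw [ihs h, iht h']
    | beta => cases hs

theorem LamFree.eq_of_reflTransGen {s t : LambdaTerm} (hs : LamFree s)
    (h : Relation.ReflTransGen Par s t) : t = s := by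
  induction h with
  | refl => rfl
  | tail _ h ih => subst ih; exact hs.eq_of_par h

theorem LamFree.eq_of_betaEta {s t : LambdaTerm} (hs : LamFree s) (ht : LamFree t)
    (h : BetaEta s t) : s = t := by
  obtain ⟨c, hc, hc'⟩ := h.join
  rw [← hs.eq_of_reflTransGen hc, ht.eq_of_reflTransGen hc']

/-! ### The applicative structure of terms modulo `βη` -/

/-- `βη`-equivalence as a setoid. -/
def betaEtaSetoid : Setoid LambdaTerm := ⟨BetaEta, .refl, .symm, .trans⟩

/-- `λ`-terms modulo `βη`-equivalence. -/
def Class : Type := Quotient betaEtaSetoid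

/-- The class of a term. -/
def toClass (t : LambdaTerm) : Class := Quotient.mk betaEtaSetoid t

theorem toClass_eq {s t : LambdaTerm} : toClass s = toClass t ↔ BetaEta s t :=
  Quotient.eq (r := betaEtaSetoid)

namespace Class

/-- Application of classes. -/
def app : Class → Class → Class :=
  Quotient.map₂ LambdaTerm.app fun _ _ h _ _ h' => BetaEta.congrApp h h'

/-- The class of the combinator `B`. -/
def B : Class := toClass bluebird

/-- The class of the identity. -/
def I : Class := toClass (lam (var 0))

/-- Composition of classes. -/
def comp (x y : Class) : Class := app (app B x) y

theorem I_app (x : Class) : app I x = x := by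
  induction x using Quotient.inductionOn with
  | h x => exact toClass_eq.2 (.beta _ _)

theorem comp_app (x y z : Class) : app (comp x y) z = app x (app y z) := by
  induction x using Quotient.inductionOn with
  | h x =>
  induction y using Quotient.inductionOn with
  | h y =>
  induction z using Quotient.inductionOn with
  | h z =>
  refine toClass_eq.2 ?_
  refine .trans (.congrApp (.congrApp (.beta _ _) (.refl y)) (.refl z)) ?_
  refine .trans (.congrApp (.beta _ _) (.refl z)) ?_
  refine .trans (.beta _ _) ?_
  simp only [subst, liftSubst, single]
  rw [subst_liftSubst_shift, subst_single_shift, subst_single_shift]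
  change BetaEta (.app x (.app (subst (single z) (shift y)) z)) _
  rw [subst_single_shift]
  exact .refl _

end Class

/-- Extensionality from `η`: it suffices to compare values at a fresh variable. -/
theorem BetaEta.ext {s t : LambdaTerm}
    (h : toClass (app (shift s) (var 0)) = toClass (app (shift t) (var 0))) : BetaEta s t :=
  .trans (.symm (.eta s)) (.trans (.congrLam (toClass_eq.1 h)) (.eta t))

theorem toClass_app (s t : LambdaTerm) : toClass (app s t) = (toClass s).app (toClass t) := rfl

theorem toClass_bluebird : toClass bluebird = Class.B := rfl

theorem shift_app (s t : LambdaTerm) : shift (app s t) = app (shift s) (shift t) := rfl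

theorem shift_bluebird : shift bluebird = bluebird := rfl

namespace Class

theorem comp_assoc (x y z : Class) : comp (comp x y) z = comp x (comp y z) := by
  induction x using Quotient.inductionOn with
  | h x =>
  induction y using Quotient.inductionOn with
  | h y =>
  induction z using Quotient.inductionOn with
  | h z =>
  refine toClass_eq.2 (.ext ?_)
  simp only [shift_app, shift_bluebird, toClass_app, toClass_bluebird, ← comp.eq_1, comp_app]

theorem B_app_comp (x y : Class) : app B (comp x y) = comp (app B x) (app B y) := by
  induction x using Quotient.inductionOn with
  | h x =>
  induction y using Quotient.inductionOn with
  | h y =>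
  refine toClass_eq.2 (.ext (toClass_eq.2 (.ext ?_)))
  simp only [shift_app, shift_bluebird, toClass_app, toClass_bluebird, ← comp.eq_1, comp_app]

/-- This is `B_app_comp` read as an equality of functions of `y`. -/
theorem B_comp (x : Class) : comp B (app B x) = comp (app B (app B x)) B := by
  induction x using Quotient.inductionOn with
  | h x =>
  refine toClass_eq.2 (.ext ?_)
  simp only [shift_app, shift_bluebird, toClass_app, toClass_bluebird, ← comp.eq_1, comp_app,
    B_app_comp]

theorem comp_I (x : Class) : comp x I = x := by
  induction x using Quotient.inductionOn with
  | h x =>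
  refine toClass_eq.2 (.ext ?_)
  change app (comp (toClass (shift x)) I) (toClass (var 0)) = _
  rw [comp_app, I_app]
  rfl

theorem I_comp (x : Class) : comp I x = x := by
  induction x using Quotient.inductionOn with
  | h x =>
  refine toClass_eq.2 (.ext ?_)
  change app (comp I (toClass (shift x))) (toClass (var 0)) = _
  rw [comp_app, I_app]
  rfl

theorem B_app_I : app B I = I := by
  refine toClass_eq.2 (.ext ?_)
  change comp I (toClass (var 0)) = app I (toClass (var 0))
  rw [I_comp, I_app]

/-! ### Polynomials modulo `βη` and sorting of degrees -/

/-- The class of the monomial `Bⁿ B`. -/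
def monomial (n : ℕ) : Class := toClass (BTerm.monomial n).toLambda

theorem monomial_succ (n : ℕ) : monomial (n + 1) = app B (monomial n) := rfl

/-- The composition of the monomials whose degrees are listed. -/
def poly (l : List ℕ) : Class := l.foldr (fun n x => comp (monomial n) x) I

theorem poly_cons (n : ℕ) (l : List ℕ) : poly (n :: l) = comp (monomial n) (poly l) := rfl

theorem poly_append (l m : List ℕ) : poly (l ++ m) = comp (poly l) (poly m) := by
  induction l with
  | nil => exact (I_comp _).symm
  | cons n l ih => rw [List.cons_append, poly_cons, poly_cons, ih, comp_assoc]

theorem B_app_poly (l : List ℕ) : app B (poly l) = poly (l.map (· + 1)) := by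
  induction l with
  | nil => exact B_app_I
  | cons n l ih => rw [poly_cons, B_app_comp, ih, List.map_cons, poly_cons, monomial_succ]

/-- The monomials of `l` act one at a time, from the right: degree `0` raises all degrees by one,
and degree `n + 1` prepends `n`. -/
theorem exists_poly_eq_app (l : List ℕ) {m : List ℕ} (hm : m ≠ []) :
    ∃ l', l' ≠ [] ∧ app (poly l) (poly m) = poly l' := by
  induction l with
  | nil => exact ⟨m, hm, I_app _⟩
  | cons n l ih =>
    obtain ⟨l', hl', h⟩ := ih
    rw [poly_cons, comp_app, h]
    cases n with
    | zero => exact ⟨l'.map (· + 1), by simpa using hl', B_app_poly l'⟩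
    | succ n => exact ⟨n :: l', List.cons_ne_nil _ _, rfl⟩

/-- For `n = 0` this is `B_comp`, as `m > 0` makes the second monomial a value of `B`; applying the
endomorphism `B` raises both degrees. -/
theorem monomial_comp_monomial {m n : ℕ} (h : n < m) :
    comp (monomial n) (monomial m) = comp (monomial (m + 1)) (monomial n) := by
  induction n generalizing m with
  | zero =>
    obtain ⟨k, rfl⟩ := Nat.exists_eq_add_of_lt h
    rw [Nat.zero_add]
    exact B_comp (monomial k)
  | succ n ih =>
    obtain ⟨k, rfl⟩ := Nat.exists_eq_add_of_lt h
    rw [monomial_succ, monomial_succ, ← B_app_comp, ih (by omega), B_app_comp]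
    rfl

/-- Insertion of a degree into a decreasing list by means of `monomial_comp_monomial`. -/
def insertDegree (n : ℕ) : List ℕ → List ℕ
  | [] => [n]
  | m :: l => if n < m then (m + 1) :: insertDegree n l else n :: m :: l

theorem poly_insertDegree (n : ℕ) (l : List ℕ) : poly (insertDegree n l) = poly (n :: l) := by
  induction l with
  | nil => rfl
  | cons m l ih =>
    rw [insertDegree]
    split_ifs with h
    · rw [poly_cons, ih, poly_cons, ← comp_assoc, ← monomial_comp_monomial h, comp_assoc]
      rfl
    · rfl

theorem insertDegree_ne_nil (n : ℕ) (l : List ℕ) : insertDegree n l ≠ [] := by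
  cases l with
  | nil => simp [insertDegree]
  | cons m l => rw [insertDegree]; split_ifs <;> simp

/-- Insertion raises old degrees by at most one, so a head that was itself raised still dominates
the tail. -/
theorem le_of_mem_insertDegree {n k : ℕ} {l : List ℕ} (hn : n ≤ k + 1) (hl : ∀ m ∈ l, m ≤ k) :
    ∀ m ∈ insertDegree n l, m ≤ k + 1 := by
  induction l with
  | nil => simpa [insertDegree] using hn
  | cons m l ih =>
    rw [List.forall_mem_cons] at hl
    have hl' : ∀ a ∈ l, a ≤ k + 1 := fun a ha => (hl.2 a ha).trans (Nat.le_succ k)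
    rw [insertDegree]
    split_ifs with h
    · exact List.forall_mem_cons.2 ⟨Nat.succ_le_succ hl.1, ih hl.2⟩
    · exact List.forall_mem_cons.2 ⟨hn, List.forall_mem_cons.2 ⟨hl.1.trans (Nat.le_succ k), hl'⟩⟩

theorem pairwise_insertDegree (n : ℕ) {l : List ℕ} (hl : l.Pairwise (· ≥ ·)) :
    (insertDegree n l).Pairwise (· ≥ ·) := by
  induction l with
  | nil => exact List.pairwise_singleton _ _
  | cons m l ih =>
    have hl' := List.pairwise_cons.1 hl
    rw [insertDegree]
    split_ifs with h
    · exact List.pairwise_cons.2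
        ⟨le_of_mem_insertDegree (by omega) hl'.1, ih hl'.2⟩
    · refine List.pairwise_cons.2 ⟨List.forall_mem_cons.2 ⟨not_lt.1 h, fun a ha => ?_⟩, hl⟩
      exact (hl'.1 a ha).trans (not_lt.1 h)

theorem exists_pairwise_poly_eq {l : List ℕ} (hl : l ≠ []) :
    ∃ l' : List ℕ, l' ≠ [] ∧ l'.Pairwise (· ≥ ·) ∧ poly l = poly l' := by
  have key : ∀ l : List ℕ, ∃ l' : List ℕ, l'.Pairwise (· ≥ ·) ∧ poly l = poly l' := by
    intro l
    induction l with
    | nil => exact ⟨[], .nil, rfl⟩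
    | cons n l ih =>
      obtain ⟨l', h, e⟩ := ih
      exact ⟨insertDegree n l', pairwise_insertDegree n h, by
        rw [poly_insertDegree, poly_cons, poly_cons, e]⟩
  cases l with
  | nil => exact absurd rfl hl
  | cons n l =>
    obtain ⟨l', h, e⟩ := key l
    exact ⟨insertDegree n l', insertDegree_ne_nil n l', pairwise_insertDegree n h, by
      rw [poly_insertDegree, poly_cons, poly_cons, e]⟩

end Class

theorem exists_poly_eq_toClass (e : BTerm) :
    ∃ l, l ≠ [] ∧ toClass e.toLambda = Class.poly l := by
  induction e with
  | B => exact ⟨[0], List.cons_ne_nil _ _, (Class.comp_I _).symm⟩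
  | app s t hs ht =>
    obtain ⟨l, _, hl⟩ := hs
    obtain ⟨m, hm, hm'⟩ := ht
    obtain ⟨l', hl', h⟩ := Class.exists_poly_eq_app l hm
    exact ⟨l', hl', by rw [← h, ← hl, ← hm']; rfl⟩

theorem toClass_toBTerm (P : BPolynomial) :
    toClass P.toBTerm.toLambda = Class.poly P.degrees := by
  induction P with
  | monomial n => exact (Class.comp_I _).symm
  | comp P Q hP hQ => rw [BPolynomial.degrees, Class.poly_append, ← hP, ← hQ]; rfl

theorem exists_degrees_eq {l : List ℕ} (hl : l ≠ []) : ∃ P : BPolynomial, P.degrees = l := by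
  induction l with
  | nil => exact absurd rfl hl
  | cons n l ih =>
    rcases eq_or_ne l [] with rfl | h
    · exact ⟨.monomial n, rfl⟩
    · obtain ⟨P, rfl⟩ := ih h
      exact ⟨.comp (.monomial n) P, rfl⟩

/-! ### The action of polynomials on sequences of arguments -/

/-- The application of `t` to the first `N` terms of the sequence `f`. -/
def spine (t : LambdaTerm) (f : ℕ → LambdaTerm) : ℕ → LambdaTerm
  | 0 => t
  | N + 1 => app (spine t f N) (f N)

/-- Replace two consecutive terms of a sequence, from index `n` on, by their application. -/
def merge (n : ℕ) (f : ℕ → LambdaTerm) (i : ℕ) : LambdaTerm :=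
  if i < n then f i else if i = n then app (f n) (f (n + 1)) else f (i + 1)

/-- Successive merging at the indices in a list. -/
def mergeAll (l : List ℕ) (f : ℕ → LambdaTerm) : ℕ → LambdaTerm :=
  l.foldl (fun g n => merge n g) f

theorem spine_congr {s t : LambdaTerm} (h : BetaEta s t) (f : ℕ → LambdaTerm) (N : ℕ) :
    BetaEta (spine s f N) (spine t f N) := by
  induction N with
  | zero => exact h
  | succ N ih => exact .congrApp ih (.refl _)

theorem spine_succ_left (t : LambdaTerm) (f : ℕ → LambdaTerm) (N : ℕ) :
    spine t f (N + 1) = spine (app t (f 0)) (fun i => f (i + 1)) N := by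
  induction N with
  | zero => rfl
  | succ N ih => rw [spine, ih]; rfl

theorem bluebird_app (x y z : LambdaTerm) :
    BetaEta (app (app (app bluebird x) y) z) (app x (app y z)) :=
  toClass_eq.1 (Class.comp_app (toClass x) (toClass y) (toClass z))

theorem spine_monomial {n N : ℕ} (h : n < N) (x : LambdaTerm) (f : ℕ → LambdaTerm) :
    BetaEta (spine (app (BTerm.monomial n).toLambda x) f (N + 1)) (spine x (merge n f) N) := by
  induction n generalizing x f N with
  | zero =>
    obtain ⟨N, rfl⟩ := Nat.exists_eq_add_of_lt h
    rw [Nat.zero_add, spine_succ_left, spine_succ_left, spine_succ_left x]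
    exact spine_congr (bluebird_app _ _ _) _ _
  | succ n ih =>
    obtain ⟨N, rfl⟩ : ∃ M, N = M + 1 := ⟨N - 1, by omega⟩
    rw [spine_succ_left, spine_succ_left x]
    -- `B (B^n B) x (f 0)` becomes `B^n B (x (f 0))`: the head absorbs one argument and the merging
    -- index drops by one.
    refine .trans (spine_congr (bluebird_app _ _ _) _ _) ?_
    refine .trans (ih (by omega) _ _) ?_
    have h₀ : merge (n + 1) f 0 = f 0 := if_pos n.succ_pos
    have h₁ : (fun i => merge (n + 1) f (i + 1)) = merge n fun i => f (i + 1) := by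
      funext i
      simp [merge]
    rw [h₀, h₁]
    exact .refl _

/-- `(P ∘ Q) x = P (Q x)`, so the merges of `P` come first, and each merge uses up one argument. -/
theorem spine_toBTerm (P : BPolynomial) {N : ℕ} (hN : ∀ n ∈ P.degrees, n < N)
    (x : LambdaTerm) (f : ℕ → LambdaTerm) :
    BetaEta (spine (app P.toBTerm.toLambda x) f (N + P.degrees.length))
      (spine x (mergeAll P.degrees f) N) := by
  induction P generalizing N x f with
  | monomial n => exact spine_monomial (hN n (List.mem_singleton_self n)) x f
  | comp P Q hP hQ =>
    simp only [BPolynomial.degrees, List.mem_append] at hN ⊢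
    rw [mergeAll, List.foldl_append, List.length_append, Nat.add_comm P.degrees.length,
      ← Nat.add_assoc]
    refine .trans (spine_congr (bluebird_app _ _ _) _ _) ?_
    refine .trans (hP (fun n hn => (hN n (.inl hn)).trans_le (Nat.le_add_right _ _)) _ _) ?_
    exact hQ (fun n hn => hN n (.inr hn)) _ _

theorem mergeAll_concat (l : List ℕ) (n : ℕ) (f : ℕ → LambdaTerm) :
    mergeAll (l ++ [n]) f = merge n (mergeAll l f) := by
  simp [mergeAll]

theorem mergeAll_apply_of_lt {l : List ℕ} {f : ℕ → LambdaTerm} {i : ℕ} (h : ∀ n ∈ l, i < n) :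
    mergeAll l f i = f i := by
  induction l using List.reverseRecOn with
  | nil => rfl
  | append_singleton l n ih =>
    rw [mergeAll_concat, merge, if_pos (h n (by simp))]
    exact ih fun m hm => h m (by simp [hm])

/-- Merging loses nothing, since `app` is injective. -/
theorem eq_of_merge_eq {n N : ℕ} (hn : n < N) {f g : ℕ → LambdaTerm}
    (h : ∀ i < N, merge n f i = merge n g i) : ∀ i < N, f i = g i := by
  intro i hi
  rcases lt_trichotomy i n with hin | rfl | hin
  · simpa [merge, hin] using h i hi
  · have := h i hi
    simp only [merge, lt_irrefl, if_false, if_true, app.injEq] at this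
    exact this.1
  · obtain ⟨j, rfl⟩ : ∃ j, i = j + 1 := ⟨i - 1, by omega⟩
    rcases (Nat.lt_succ_iff.1 hin).eq_or_lt with rfl | hj
    · have := h n hn
      simp only [merge, lt_irrefl, if_false, if_true, app.injEq] at this
      exact this.2
    · simpa [merge, hj.not_gt, hj.ne'] using h j (by omega)

theorem mergeAll_concat_ne_var {l : List ℕ} {n : ℕ} {f : ℕ → LambdaTerm} (k : ℕ) :
    mergeAll (l ++ [n]) f n ≠ var k := by
  simp [mergeAll_concat, merge]

theorem lt_of_mem_concat {l : List ℕ} {n i : ℕ} (h : (l ++ [n]).Pairwise (· ≥ ·)) (hi : i < n) :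
    ∀ m ∈ l ++ [n], i < m := by
  intro m hm
  rcases List.mem_append.1 hm with hm | hm
  · exact hi.trans_le ((List.pairwise_append.1 h).2.2 m hm n (List.mem_singleton_self n))
  · rwa [List.mem_singleton.1 hm]

theorem eq_of_mergeAll_eq {N : ℕ} {l m : List ℕ} (hl : l.Pairwise (· ≥ ·))
    (hm : m.Pairwise (· ≥ ·)) (hlN : ∀ n ∈ l, n < N) (hmN : ∀ n ∈ m, n < N)
    (h : ∀ i < N, mergeAll l var i = mergeAll m var i) : l = m := by
  induction l using List.reverseRecOn generalizing m with
  | nil =>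
    induction m using List.reverseRecOn with
    | nil => rfl
    | append_singleton m n => exact absurd (h n (hmN n (by simp))).symm (mergeAll_concat_ne_var n)
  | append_singleton l n ih =>
    have hn : n < N := hlN n (by simp)
    induction m using List.reverseRecOn with
    | nil => exact absurd (h n hn) (mergeAll_concat_ne_var n)
    | append_singleton m k =>
      have hk : k < N := hmN k (by simp)
      -- The last degree is the least index holding a non-variable: earlier entries are untouched,
      -- while this one is an application.
      obtain rfl : n = k := by
        rcases lt_trichotomy n k with hnk | hnk | hnk
        · exact absurd ((h n hn).trans (mergeAll_apply_of_lt (lt_of_mem_concat hm hnk)))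
            (mergeAll_concat_ne_var n)
        · exact hnk
        · exact absurd ((h k hk).symm.trans (mergeAll_apply_of_lt (lt_of_mem_concat hl hnk)))
            (mergeAll_concat_ne_var k)
      simp only [mergeAll_concat] at h
      rw [ih (List.pairwise_append.1 hl).1 (List.pairwise_append.1 hm).1
        (fun i hi => hlN i (by simp [hi])) (fun i hi => hmN i (by simp [hi]))
        (eq_of_merge_eq hn h)]

theorem lamFree_mergeAll (l : List ℕ) (i : ℕ) : LamFree (mergeAll l var i) := by
  induction l using List.reverseRecOn generalizing i with
  | nil => exact .var i
  | append_singleton l n ih =>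
    rw [mergeAll_concat, merge]
    split_ifs
    exacts [ih _, .app (ih _) (ih _), ih _]

theorem lamFree_spine {t : LambdaTerm} (ht : LamFree t) {f : ℕ → LambdaTerm}
    (hf : ∀ i, LamFree (f i)) (N : ℕ) : LamFree (spine t f N) := by
  induction N with
  | zero => exact ht
  | succ N ih => exact .app ih (hf N)

theorem eq_of_spine_eq {k N M : ℕ} {f g : ℕ → LambdaTerm}
    (h : spine (var k) f N = spine (var k) g M) : N = M ∧ ∀ i < N, f i = g i := by
  induction N generalizing M with
  | zero =>
    cases M with
    | zero => exact ⟨rfl, fun i hi => absurd hi (Nat.not_lt_zero i)⟩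
    | succ M => simp [spine] at h
  | succ N ih =>
    cases M with
    | zero => simp [spine] at h
    | succ M =>
      rw [spine, spine, app.injEq] at h
      obtain ⟨rfl, h'⟩ := ih h.1
      refine ⟨rfl, fun i hi => ?_⟩
      rcases (Nat.lt_succ_iff.1 hi).eq_or_lt with rfl | hi
      exacts [h.2, h' i hi]

theorem degrees_eq_of_betaEta {P Q : BPolynomial} (hP : P.Decreasing) (hQ : Q.Decreasing)
    (h : BetaEta P.toBTerm.toLambda Q.toBTerm.toLambda) : P.degrees = Q.degrees := by
  have bound : ∀ l : List ℕ, ∀ n ∈ l, n < l.sum + 1 := fun l n hn =>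
    Nat.lt_succ_of_le (List.le_sum_of_mem hn)
  have hN : ∀ n ∈ P.degrees, n < P.degrees.sum + Q.degrees.sum + 1 := fun n hn => by
    have := bound _ n hn; omega
  have hN' : ∀ n ∈ Q.degrees, n < P.degrees.sum + Q.degrees.sum + 1 := fun n hn => by
    have := bound _ n hn; omega
  generalize P.degrees.sum + Q.degrees.sum + 1 = N at hN hN'
  -- Both polynomials receive `N + |P| + |Q|` arguments, with `|·|` the number of degrees, so that
  -- `h` applies. Reusing `var 0` as head and first argument is harmless: only positions in the
  -- spine are compared.
  have h₁ := spine_toBTerm P (N := N + Q.degrees.length)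
    (fun n hn => (hN n hn).trans_le (Nat.le_add_right _ _)) (var 0) var
  have h₂ := spine_toBTerm Q (N := N + P.degrees.length)
    (fun n hn => (hN' n hn).trans_le (Nat.le_add_right _ _)) (var 0) var
  rw [Nat.add_right_comm] at h₂
  have h₃ := h₁.symm.trans ((spine_congr (.congrApp h (.refl (var 0))) var _).trans h₂)
  have h₄ := eq_of_spine_eq (LamFree.eq_of_betaEta
    (lamFree_spine (.var 0) (lamFree_mergeAll _) _)
    (lamFree_spine (.var 0) (lamFree_mergeAll _) _) h₃)
  exact eq_of_mergeAll_eq hP hQ hN hN'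
    fun i hi => h₄.2 i (hi.trans_le (Nat.le_add_right _ _))

end LambdaTerm

/-- Every `B`-term is equivalent to a decreasing polynomial, and a decreasing polynomial is
equivalent to it exactly when it has the same sequence of degrees. -/
theorem mainTheorem1 (e : BTerm) :
    ∃ P : BPolynomial, P.Decreasing ∧ e.Equivalent P.toBTerm ∧
      ∀ Q : BPolynomial, Q.Decreasing →
        (e.Equivalent Q.toBTerm ↔ Q.degrees = P.degrees) := by
  obtain ⟨l, hl, hel⟩ := LambdaTerm.exists_poly_eq_toClass e
  obtain ⟨l', hl', hdec, hll'⟩ := LambdaTerm.Class.exists_pairwise_poly_eq hl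
  obtain ⟨P, rfl⟩ := LambdaTerm.exists_degrees_eq hl'
  have heP : e.Equivalent P.toBTerm :=
    LambdaTerm.toClass_eq.1 (by rw [hel, hll', LambdaTerm.toClass_toBTerm])
  refine ⟨P, hdec, heP, fun Q hQ => ⟨fun h => ?_, fun h => ?_⟩⟩
  · exact LambdaTerm.degrees_eq_of_betaEta hQ hdec (h.symm.trans heP)
  · exact LambdaTerm.toClass_eq.1 (by
      rw [hel, hll', LambdaTerm.toClass_toBTerm, h])
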